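/- Let $\mathbb N=\{1,2,\dots\}$. For a nonnegative sequence $u=(u_k)_{k\ge1}$ put $m_i(u)=\sum_{k\ge1}k^iu_k$. For $n\in\mathbb N$, a sequence $c=(c_k)_{k\ge1}$ of nonnegative reals is said to solve $(E_n)$ if $$m_1(c)=1,\qquad \Big(2+\frac{k-1}{n}\Big)c_k=\frac1{m_0(c)}\sum_{i=1}^{k-1}c_ic_{k-i}\quad(k\ge2).$$ **Theorem.** For each $n\in\mathbb N$, $(E_n)$ has a unique solution $c^n=(c^n_k)_{k\ge1}$. Let $p^n_k=c^n_k/m_0(c^n)$ be the corresponding probability distribution on $\{1,2,\dots\}$. Then $$\lim_{n\to\infty}\sum_{k\ge1}|p^n_k-p_k|=0,\qquad\text{where}\quad p_k:=\frac{2}{4^k\,k}\binom{2k-2}{k-1}.$$ The sequence $(p_k)_{k\ge1}$ is the law of the number of leaves of a critical binary Galton–Watson tree, that is, of a Galton–Watson tree with offspring distribution $\frac12(\delta_0+\delta_2)$. It is the unique nonnegative solution to $$\sum_{k\ge1}p_k=1,\qquad p_k=\frac12\sum_{i=1}^{k-1}p_ip_{k-i}\quad(k\ge2).$$ Finally, $p_k\sim\dfrac{1}{2\sqrt\pi\,k^{3/2}}$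 as $k\to\infty$. -/

import Mathlib

open Filter Topology MeasureTheory ProbabilityTheory Asymptotics
open scoped ENNReal

noncomputable section

namespace ForestFire

/-! Sequences `(u_k)_{k ≥ 1}` are functions `ℕ → ℝ`; the index `0` carries no information, and
the predicates below require `u 0 = 0` so that uniqueness is meaningful. Sums over `k ≥ 1` are
written with the summation index shifted by one. -/

/-- The moment `m_i(u) = ∑_{k ≥ 1} k^i u_k`. -/
def moment (i : ℕ) (u : ℕ → ℝ) : ℝ := ∑' k : ℕ, ((k + 1 : ℕ) : ℝ) ^ i * u (k + 1)

/-- `c` is an equilibrium state with total mass `1` of the coagulation-fragmentation system with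
fire rate `1 / n`. (The sum defining `m_1` converges because its value is not `0`, and hence so
does the sum defining `m_0`.) -/
structure IsEquilibrium (n : ℕ) (c : ℕ → ℝ) : Prop where
  zero : c 0 = 0
  nonneg : ∀ k, 0 ≤ c k
  mass : moment 1 c = 1
  balance : ∀ k : ℕ, 2 ≤ k →
    (2 + ((k : ℝ) - 1) / n) * c k = 1 / moment 0 c * ∑ i ∈ Finset.Ico 1 k, c i * c (k - i)

/-- The particles' mass distribution `c_k / m_0(c)`. -/
def massDist (c : ℕ → ℝ) (k : ℕ) : ℝ := c k / moment 0 c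

/-- The limit law `p_k = 2 / (4^k k) * binom (2k-2) (k-1)` for `k ≥ 1`, with `p_0 = 0`. -/
def limitLaw (k : ℕ) : ℝ :=
  if k = 0 then 0 else 2 / (4 ^ k * (k : ℝ)) * (Nat.choose (2 * k - 2) (k - 1) : ℝ)

/-- Nonnegative solutions of `∑_{k ≥ 1} q_k = 1`, `q_k = 1/2 ∑_{i=1}^{k-1} q_i q_{k-i}`, `k ≥ 2`. -/
structure IsLimitSolution (q : ℕ → ℝ) : Prop where
  zero : q 0 = 0
  nonneg : ∀ k, 0 ≤ q k
  hasSum : HasSum (fun k => q (k + 1)) 1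
  balance : ∀ k : ℕ, 2 ≤ k → q k = 1 / 2 * ∑ i ∈ Finset.Ico 1 k, q i * q (k - i)

/-- The rooted tree, as a set of words (the root is `[]`, the children of `u` are `u ++ [i]`),
in which the individual `u` has the `ξ u` children `u ++ [0], …, u ++ [ξ u - 1]`. -/
def tree (ξ : List ℕ → ℕ) : Set (List ℕ) := {u | ∀ v i, v ++ [i] <+: u → i < ξ v}

/-- The leaves of the tree: its vertices without children. -/
def leaves (ξ : List ℕ → ℕ) : Set (List ℕ) := {u | u ∈ tree ξ ∧ ξ u = 0}

/-- The numbers of children `ξ u` of all potential individuals are independent with law `ν`, that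
is, `tree (fun u => ξ u ω)` is a Galton-Watson tree with offspring distribution `ν`. -/
structure IsGaltonWatson {Ω : Type*} [MeasurableSpace Ω] (P : Measure Ω) (ν : Measure ℕ)
    (ξ : List ℕ → Ω → ℕ) : Prop where
  measurable : ∀ u, Measurable (ξ u)
  indep : iIndepFun ξ P
  law : ∀ u, P.map (ξ u) = ν

/-- The critical binary offspring distribution `(δ_0 + δ_2) / 2`. -/
def criticalBinary : Measure ℕ :=
  (2⁻¹ : ℝ≥0∞) • (Measure.dirac 0 + Measure.dirac 2)

end ForestFire

end

/-! Dividing an equilibrium by `m_0` gives a probability law with `w_k q_k = ∑ q_i q_{k-i}`, `w_k =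
2 + (k-1)/n`; dividing such a law with finite mean by `m_1` goes back. The recursion is homogeneous,
so its nonnegative solutions are `q_k = b_k x^k`, where `x = q_1` and `b` is `convSeq`, and
everything reduces to the equation `∑ b_k x^k = 1`.

Solutions are monotone in `q_1` and antitone in the weights (`ConvRec.le`), and two ordered laws of
equal mass coincide; this is uniqueness. For existence, take the largest `x` at which all partial
sums are at most `1`. A differential inequality bounds their slopes uniformly, so a total below `1`
would allow a larger `x`; it also makes the mean finite.

The limit law is the solution for constant weight `2`, with `x = 1/2`. Comparison with it gives `q_1
≥ 1/2`; past `1/2` its generating function exceeds `1`, which forces `q_1 → 1/2`. Pointwise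
convergence follows, and Scheffé's lemma upgrades it to `ℓ¹`. For the tree, splitting at the root
gives the same recursion. -/

namespace ForestFire

/-! ### The limit law: Catalan numbers, total mass and asymptotics -/

theorem limitLaw_zero : limitLaw 0 = 0 := by simp [limitLaw]

theorem limitLaw_succ (k : ℕ) :
    limitLaw (k + 1) = (Nat.centralBinom k : ℝ) / 4 ^ k / (2 * (k + 1)) := by
  rw [limitLaw, if_neg (Nat.succ_ne_zero k), show 2 * (k + 1) - 2 = 2 * k by lia,
    Nat.add_sub_cancel, Nat.centralBinom_eq_two_mul_choose]
  push_cast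
  field_simp
  ring

theorem limitLaw_succ_eq_catalan (k : ℕ) :
    limitLaw (k + 1) = (catalan k : ℝ) / (2 * 4 ^ k) := by
  have h : ((k : ℝ) + 1) * catalan k = Nat.centralBinom k := by
    exact_mod_cast succ_mul_catalan_eq_centralBinom k
  rw [limitLaw_succ, ← h]
  field_simp

theorem limitLaw_one : limitLaw 1 = 1 / 2 := by
  simp [limitLaw_succ_eq_catalan 0]

theorem limitLaw_pos {k : ℕ} (hk : 1 ≤ k) : 0 < limitLaw k := by
  obtain ⟨k, rfl⟩ := Nat.exists_eq_add_of_le' hk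
  have := Nat.centralBinom_pos k
  rw [limitLaw_succ]
  positivity

theorem limitLaw_nonneg (k : ℕ) : 0 ≤ limitLaw k := by
  rcases Nat.eq_zero_or_pos k with rfl | hk
  · exact limitLaw_zero.ge
  · exact (limitLaw_pos hk).le

theorem sum_Ico_one_mul_eq_sum_range {M : Type*} [NonUnitalNonAssocSemiring M] (f g : ℕ → M)
    (k : ℕ) :
    ∑ i ∈ Finset.Ico 1 (k + 2), f i * g (k + 2 - i) =
      ∑ i ∈ Finset.range (k + 1), f (i + 1) * g (k - i + 1) := by
  rw [Finset.sum_Ico_eq_sum_range]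
  refine Finset.sum_congr rfl fun i hi => ?_
  rw [Finset.mem_range] at hi
  rw [add_comm 1 i, show k + 2 - (i + 1) = k - i + 1 by lia]

theorem limitLaw_balance {k : ℕ} (hk : 2 ≤ k) :
    limitLaw k = 1 / 2 * ∑ i ∈ Finset.Ico 1 k, limitLaw i * limitLaw (k - i) := by
  obtain ⟨k, rfl⟩ := Nat.exists_eq_add_of_le' hk
  rw [sum_Ico_one_mul_eq_sum_range, limitLaw_succ_eq_catalan (k + 1), catalan_succ',
    Finset.Nat.sum_antidiagonal_eq_sum_range_succ (fun i j => catalan i * catalan j)]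
  push_cast
  rw [Finset.sum_div, Finset.mul_sum]
  refine Finset.sum_congr rfl fun i hi => ?_
  have hi : i ≤ k := Nat.lt_succ_iff.1 (Finset.mem_range.1 hi)
  rw [limitLaw_succ_eq_catalan, limitLaw_succ_eq_catalan]
  have h4 : (4 : ℝ) ^ (k + 1) = 4 * (4 ^ i * 4 ^ (k - i)) := by
    rw [← pow_add, Nat.add_sub_cancel' hi, pow_succ, mul_comm]
  rw [h4]
  field_simp
  ring

/-- The factorial form of the Wallis product makes `W n * (2n + 1)` a perfect square. Both the total
mass and the asymptotics of the limit law then follow from `W n → π/2`. -/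
theorem centralBinom_div_four_pow_eq (n : ℕ) :
    (Nat.centralBinom n : ℝ) / 4 ^ n = 1 / √(Real.Wallis.W n * (2 * n + 1)) := by
  have hfac : (Nat.centralBinom n : ℝ) * ((n.factorial : ℝ) * n.factorial) =
      (2 * n).factorial := by
    have := Nat.choose_mul_factorial_mul_factorial (show n ≤ 2 * n by lia)
    rw [show 2 * n - n = n by lia, mul_assoc, ← Nat.centralBinom_eq_two_mul_choose] at this
    exact_mod_cast this
  have hW : Real.Wallis.W n * (2 * n + 1) = (4 ^ n / (Nat.centralBinom n : ℝ)) ^ 2 := by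
    have h1 := Nat.factorial_pos n
    have h2 := Nat.centralBinom_pos n
    rw [Real.Wallis.W_eq_factorial_ratio, ← hfac, show (2 : ℝ) ^ (4 * n) = (4 ^ n) ^ 2 by
      rw [← pow_mul, show (4 : ℝ) = 2 ^ 2 by norm_num, ← pow_mul]; ring_nf]
    field_simp
  rw [hW, Real.sqrt_sq (by positivity), one_div_div]

theorem tendsto_centralBinom_div_four_pow :
    Tendsto (fun n : ℕ => (Nat.centralBinom n : ℝ) / 4 ^ n) atTop (𝓝 0) := by
  simp only [centralBinom_div_four_pow_eq, one_div]
  refine (Real.tendsto_sqrt_atTop.comp ?_).inv_tendsto_atTop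
  refine Real.Wallis.tendsto_W_nhds_pi_div_two.pos_mul_atTop (by positivity) ?_
  exact tendsto_atTop_add_const_right _ _
    (tendsto_natCast_atTop_atTop.const_mul_atTop (by norm_num))

/-- Telescoping: `centralBinom n / 4^n` decreases by exactly `limitLaw (n + 1)` at each step. -/
theorem sum_range_limitLaw_succ (n : ℕ) :
    ∑ k ∈ Finset.range n, limitLaw (k + 1) = 1 - (Nat.centralBinom n : ℝ) / 4 ^ n := by
  induction n with
  | zero => simp
  | succ n ih =>
    have h : ((n : ℝ) + 1) * Nat.centralBinom (n + 1) =
        2 * (2 * n + 1) * Nat.centralBinom n := by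
      exact_mod_cast Nat.succ_mul_centralBinom_succ n
    have h' : (Nat.centralBinom (n + 1) : ℝ) =
        2 * (2 * n + 1) * Nat.centralBinom n / (n + 1) := by
      rw [← h]; field_simp
    rw [Finset.sum_range_succ, ih, limitLaw_succ, h']
    field_simp
    ring

theorem hasSum_limitLaw_succ : HasSum (fun k => limitLaw (k + 1)) 1 := by
  rw [hasSum_iff_tendsto_nat_of_nonneg fun k => limitLaw_nonneg _]
  simp only [sum_range_limitLaw_succ]
  simpa using tendsto_centralBinom_div_four_pow.const_sub 1

theorem isLimitSolution_limitLaw : IsLimitSolution limitLaw where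
  zero := limitLaw_zero
  nonneg := limitLaw_nonneg
  hasSum := hasSum_limitLaw_succ
  balance _ := limitLaw_balance

theorem limitLaw_isEquivalent :
    limitLaw ~[atTop] (fun k : ℕ => 1 / (2 * √Real.pi * (k : ℝ) ^ (3 / 2 : ℝ))) := by
  refine isEquivalent_of_tendsto_one ?_
  rw [← tendsto_add_atTop_iff_nat 1]
  have hratio : ∀ k : ℕ, (limitLaw / fun k : ℕ => 1 / (2 * √Real.pi * (k : ℝ) ^ (3 / 2 : ℝ)))
      (k + 1) = √(Real.pi * (((k : ℝ) + 1) / (2 * k + 1)) / Real.Wallis.W k) := by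
    intro k
    have hW := Real.Wallis.W_pos k
    have hk : (0 : ℝ) < (k : ℝ) + 1 := by positivity
    have hpow : ((k : ℝ) + 1) ^ (3 / 2 : ℝ) = (k + 1) * √(k + 1) := by
      rw [show (3 / 2 : ℝ) = 1 + 1 / 2 by norm_num, Real.rpow_add hk, Real.rpow_one,
        Real.sqrt_eq_rpow]
    rw [Pi.div_apply, limitLaw_succ, centralBinom_div_four_pow_eq]
    push_cast
    rw [hpow, Real.sqrt_div' _ hW.le, Real.sqrt_mul Real.pi_pos.le, Real.sqrt_div' _ (by positivity),
      Real.sqrt_mul hW.le]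
    have h1 : √(2 * (k : ℝ) + 1) ≠ 0 := by positivity
    have h2 : √(Real.Wallis.W k) ≠ 0 := by positivity
    field_simp
  simp only [hratio]
  have hfrac : Tendsto (fun k : ℕ => ((k : ℝ) + 1) / (2 * k + 1)) atTop (𝓝 (1 / 2)) := by
    have := tendsto_add_mul_div_add_mul_atTop_nhds (1 : ℝ) 1 1 (two_ne_zero (α := ℝ))
    refine this.congr fun k => ?_
    ring
  have hlim := ((hfrac.const_mul Real.pi).div Real.Wallis.tendsto_W_nhds_pi_div_two
    (by positivity)).sqrt
  have hone : √(Real.pi * (1 / 2) / (Real.pi / 2)) = 1 := by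
    rw [mul_one_div, div_self (by positivity), Real.sqrt_one]
  rwa [hone] at hlim

/-! ### The convolution recursion: comparison, scaling, uniqueness -/

/-- The recursion `w_k q_k = ∑_{i=1}^{k-1} q_i q_{k-i}`, `k ≥ 2`. -/
def ConvRec (w q : ℕ → ℝ) : Prop :=
  ∀ k : ℕ, 2 ≤ k → w k * q k = ∑ i ∈ Finset.Ico 1 k, q i * q (k - i)

/-- A probability distribution on `{1, 2, …}` satisfying the recursion with weights `w`. -/
structure IsConvLaw (w q : ℕ → ℝ) : Prop where
  zero : q 0 = 0
  nonneg : ∀ k, 0 ≤ q k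
  hasSum : HasSum (fun k => q (k + 1)) 1
  convRec : ConvRec w q

/-- The solution of the recursion started from `q_1 = 1`. -/
noncomputable def convSeq (w : ℕ → ℝ) : ℕ → ℝ
  | 0 => 0
  | 1 => 1
  | k + 2 => (∑ i : Fin (k + 1), convSeq w (i + 1) * convSeq w (k - i + 1)) / w (k + 2)

/-- The weights `2 + (k - 1) / n` of the system with fire rate `1 / n`. -/
noncomputable def fireWeight (n k : ℕ) : ℝ := 2 + ((k : ℝ) - 1) / n

theorem two_le_fireWeight (n : ℕ) {k : ℕ} (hk : 2 ≤ k) : 2 ≤ fireWeight n k := by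
  have hk : (2 : ℝ) ≤ k := by exact_mod_cast hk
  have : 0 ≤ ((k : ℝ) - 1) / n := div_nonneg (by linarith) (Nat.cast_nonneg n)
  rw [fireWeight]
  linarith

theorem fireWeight_pos (n : ℕ) {k : ℕ} (hk : 2 ≤ k) : 0 < fireWeight n k :=
  two_pos.trans_le (two_le_fireWeight n hk)

theorem tendsto_fireWeight (k : ℕ) : Tendsto (fun n => fireWeight n k) atTop (𝓝 2) := by
  simpa [fireWeight] using
    (tendsto_const_div_atTop_nhds_zero_nat ((k : ℝ) - 1)).const_add 2

/-- Strong induction: the right side is increasing in the earlier nonnegative terms, and a smaller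
weight only enlarges the quotient. -/
theorem ConvRec.le {w w' q q' : ℕ → ℝ} (hw' : ∀ k, 2 ≤ k → 0 < w' k)
    (hww' : ∀ k, 2 ≤ k → w' k ≤ w k) (hq : ∀ k, 0 ≤ q k) (h : ConvRec w q) (h' : ConvRec w' q')
    (h1 : q 1 ≤ q' 1) {k : ℕ} (hk : 1 ≤ k) : q k ≤ q' k := by
  induction k using Nat.strong_induction_on with
  | _ k ih =>
    rcases hk.eq_or_lt with rfl | hk
    · exact h1
    refine le_of_mul_le_mul_left ?_ (hw' k hk)
    calc w' k * q k ≤ w k * q k := mul_le_mul_of_nonneg_right (hww' k hk) (hq k)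
      _ = ∑ i ∈ Finset.Ico 1 k, q i * q (k - i) := h k hk
      _ ≤ ∑ i ∈ Finset.Ico 1 k, q' i * q' (k - i) := by
        refine Finset.sum_le_sum fun i hi => ?_
        rw [Finset.mem_Ico] at hi
        have hi1 := ih i hi.2 hi.1
        exact mul_le_mul hi1 (ih (k - i) (by lia) (by lia)) (hq _) ((hq i).trans hi1)
      _ = w' k * q' k := (h' k hk).symm

theorem ConvRec.eq {w q q' : ℕ → ℝ} (hw : ∀ k, 2 ≤ k → 0 < w k) (hq : ∀ k, 0 ≤ q k)
    (hq' : ∀ k, 0 ≤ q' k) (h : ConvRec w q) (h' : ConvRec w q') (h1 : q 1 = q' 1) {k : ℕ}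
    (hk : 1 ≤ k) : q k = q' k :=
  le_antisymm (h.le hw (fun _ _ => le_rfl) hq h' h1.le hk)
    (h'.le hw (fun _ _ => le_rfl) hq' h h1.ge hk)

/-- Since `i + (k - i) = k`, both sides scale by `x^k`. This reaches any value of `q 1` from
`convSeq`. -/
theorem ConvRec.mul_pow {w q : ℕ → ℝ} (h : ConvRec w q) (x : ℝ) :
    ConvRec w (fun k => q k * x ^ k) := by
  intro k hk
  rw [← mul_assoc, h k hk, Finset.sum_mul]
  refine Finset.sum_congr rfl fun i hi => ?_
  rw [Finset.mem_Ico] at hi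
  conv_lhs => rw [← Nat.add_sub_cancel' hi.2.le, pow_add, Nat.add_sub_cancel' hi.2.le]
  ring

theorem convRec_limitLaw : ConvRec (fun _ => 2) limitLaw := by
  intro k hk
  rw [limitLaw_balance hk]
  ring

theorem IsLimitSolution.isConvLaw {q : ℕ → ℝ} (h : IsLimitSolution q) :
    IsConvLaw (fun _ => 2) q where
  zero := h.zero
  nonneg := h.nonneg
  hasSum := h.hasSum
  convRec k hk := by
    rw [h.balance k hk]
    ring

theorem eq_of_hasSum_of_le {f g : ℕ → ℝ} {a : ℝ} (hf : HasSum f a) (hg : HasSum g a)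
    (hfg : ∀ k, f k ≤ g k) : f = g := by
  have h := hg.sub hf
  rw [sub_self, hasSum_zero_iff_of_nonneg fun k => sub_nonneg.2 (hfg k)] at h
  exact funext fun k => (sub_eq_zero.1 (congrFun h k)).symm

/-- Ordering the first terms orders the whole sequences, and equal total mass leaves no room for a
strict inequality. -/
theorem IsConvLaw.unique {w q q' : ℕ → ℝ} (hw : ∀ k, 2 ≤ k → 0 < w k) (h : IsConvLaw w q)
    (h' : IsConvLaw w q') : q = q' := by
  wlog h1 : q 1 ≤ q' 1 generalizing q q'
  · exact (this h' h (le_of_not_ge h1)).symm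
  have hs := eq_of_hasSum_of_le h.hasSum h'.hasSum fun k =>
    h.convRec.le hw (fun _ _ => le_rfl) h.nonneg h'.convRec h1 (Nat.le_add_left 1 k)
  funext k
  rcases k with _ | k
  · rw [h.zero, h'.zero]
  · exact congrFun hs k

theorem convSeq_zero (w : ℕ → ℝ) : convSeq w 0 = 0 := by rw [convSeq]

theorem convSeq_one (w : ℕ → ℝ) : convSeq w 1 = 1 := by rw [convSeq]

theorem convSeq_add_two (w : ℕ → ℝ) (k : ℕ) : convSeq w (k + 2) =
    (∑ i ∈ Finset.range (k + 1), convSeq w (i + 1) * convSeq w (k - i + 1)) / w (k + 2) := by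
  rw [convSeq, Fin.sum_univ_eq_sum_range
    (fun i => convSeq w (i + 1) * convSeq w (k - i + 1)) (k + 1)]

theorem convRec_convSeq {w : ℕ → ℝ} (hw : ∀ k, 2 ≤ k → 0 < w k) : ConvRec w (convSeq w) := by
  intro k hk
  have hpos := hw k hk
  obtain ⟨k, rfl⟩ := Nat.exists_eq_add_of_le' hk
  rw [sum_Ico_one_mul_eq_sum_range, convSeq_add_two, mul_div_cancel₀ _ hpos.ne']

theorem convSeq_nonneg {w : ℕ → ℝ} (hw : ∀ k, 2 ≤ k → 0 < w k) (k : ℕ) : 0 ≤ convSeq w k := by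
  induction k using Nat.strong_induction_on with
  | _ k ih =>
    match k with
    | 0 => exact (convSeq_zero w).ge
    | 1 => rw [convSeq_one]; exact zero_le_one
    | k + 2 =>
      rw [convSeq_add_two]
      refine div_nonneg (Finset.sum_nonneg fun i hi => ?_) (hw _ (Nat.le_add_left 2 k)).le
      rw [Finset.mem_range] at hi
      exact mul_nonneg (ih _ (by lia)) (ih _ (by lia))

theorem IsConvLaw.eq_convSeq_mul_pow {w q : ℕ → ℝ} (hw : ∀ k, 2 ≤ k → 0 < w k)
    (h : IsConvLaw w q) (k : ℕ) : q k = convSeq w k * q 1 ^ k := by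
  rcases Nat.eq_zero_or_pos k with rfl | hk
  · rw [h.zero, convSeq_zero, zero_mul]
  · exact h.convRec.eq hw h.nonneg
      (fun k => mul_nonneg (convSeq_nonneg hw k) (pow_nonneg (h.nonneg 1) k))
      ((convRec_convSeq hw).mul_pow _) (by simp [convSeq_one]) hk

theorem limitLaw_eq_convSeq (k : ℕ) : limitLaw k = convSeq (fun _ => 2) k * (1 / 2) ^ k := by
  rw [← limitLaw_one]
  exact isLimitSolution_limitLaw.isConvLaw.eq_convSeq_mul_pow (fun _ _ => two_pos) k

theorem tendsto_convSeq {w : ℕ → ℕ → ℝ} {v : ℕ → ℝ} (hv : ∀ k, 2 ≤ k → v k ≠ 0)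
    (hw : ∀ k, 2 ≤ k → Tendsto (fun n => w n k) atTop (𝓝 (v k))) (k : ℕ) :
    Tendsto (fun n => convSeq (w n) k) atTop (𝓝 (convSeq v k)) := by
  induction k using Nat.strong_induction_on with
  | _ k ih =>
    match k with
    | 0 => simp only [convSeq_zero]; exact tendsto_const_nhds
    | 1 => simp only [convSeq_one]; exact tendsto_const_nhds
    | k + 2 =>
      simp only [convSeq_add_two]
      refine Tendsto.div (tendsto_finsetSum _ fun i hi => ?_) (hw _ (Nat.le_add_left 2 k))
        (hv _ (Nat.le_add_left 2 k))
      rw [Finset.mem_range] at hi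
      exact (ih _ (by lia)).mul (ih _ (by lia))

/-! ### Existence of a law with finite mean -/

/-- The index pairs on the left form a triangle inside the square on the right. -/
theorem sum_range_sum_range_mul_le_sq {a : ℕ → ℝ} (ha : ∀ k, 0 ≤ a k) (m : ℕ) :
    ∑ j ∈ Finset.range m, ∑ i ∈ Finset.range (j + 1), a i * a (j - i) ≤
      (∑ i ∈ Finset.range m, a i) ^ 2 := by
  rw [Finset.sum_comm' (s' := fun i => Finset.Ico i m) (t' := Finset.range m)
    (by simp only [Finset.mem_range, Finset.mem_Ico]; lia), sq, Finset.sum_mul]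
  refine Finset.sum_le_sum fun i _ => ?_
  rw [← Finset.mul_sum, Finset.sum_Ico_eq_sum_range]
  refine mul_le_mul_of_nonneg_left ?_ (ha i)
  simp only [Nat.add_sub_cancel_left]
  exact Finset.sum_le_sum_of_subset_of_nonneg (Finset.range_mono (Nat.sub_le m i))
    fun j _ _ => ha j

/-- The differential inequality for the partial sums `S` of the generating function of a solution:
`x S' ≤ n S² + 2 n x + S`, in terms of `q_k x^k`. -/
theorem sum_range_mul_le_of_convRec {n : ℕ} (hn : 1 ≤ n) {q : ℕ → ℝ} (hq : ∀ k, 0 ≤ q k)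
    (h : ConvRec (fireWeight n) q) (m : ℕ) :
    ∑ k ∈ Finset.range m, ((k : ℝ) + 1) * q (k + 1) ≤
      n * (∑ k ∈ Finset.range m, q (k + 1)) ^ 2 + 2 * n * q 1 +
        ∑ k ∈ Finset.range m, q (k + 1) := by
  have hn0 : (0 : ℝ) < n := by exact_mod_cast hn
  rcases m with _ | m
  · simpa [mul_assoc] using mul_nonneg hn0.le (hq 1)
  -- Multiplication by `n` turns the weight into the factor `k + 2` that differentiation produces;
  -- the `-2n` is discarded below.
  have hterm : ∀ k : ℕ, (k : ℝ) + 1 + 1 = (n * fireWeight n (k + 2)) + 1 - 2 * n := by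
    intro k
    rw [fireWeight]
    push_cast
    field_simp
    ring
  have hsq : ∑ k ∈ Finset.range m, fireWeight n (k + 2) * q (k + 2) ≤
      (∑ k ∈ Finset.range (m + 1), q (k + 1)) ^ 2 := by
    calc ∑ k ∈ Finset.range m, fireWeight n (k + 2) * q (k + 2)
        = ∑ j ∈ Finset.range m, ∑ i ∈ Finset.range (j + 1), q (i + 1) * q (j - i + 1) :=
          Finset.sum_congr rfl fun k _ => by
            rw [h (k + 2) (Nat.le_add_left 2 k), sum_Ico_one_mul_eq_sum_range]
      _ ≤ (∑ k ∈ Finset.range m, q (k + 1)) ^ 2 :=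
          sum_range_sum_range_mul_le_sq (a := fun k => q (k + 1)) (fun _ => hq _) m
      _ ≤ _ := by
          refine pow_le_pow_left₀ (Finset.sum_nonneg fun _ _ => hq _) ?_ 2
          rw [Finset.sum_range_succ]
          exact le_add_of_nonneg_right (hq _)
  have hle : ∑ k ∈ Finset.range m, ((k : ℝ) + 1 + 1) * q (k + 2) ≤
      n * ∑ k ∈ Finset.range m, fireWeight n (k + 2) * q (k + 2) +
        ∑ k ∈ Finset.range m, q (k + 2) := by
    rw [Finset.mul_sum, ← Finset.sum_add_distrib]
    refine Finset.sum_le_sum fun k _ => ?_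
    rw [hterm]
    nlinarith [mul_nonneg hn0.le (hq (k + 2))]
  have hmul := mul_le_mul_of_nonneg_left hsq hn0.le
  rw [Finset.sum_range_succ' (fun k : ℕ => ((k : ℝ) + 1) * q (k + 1)) m]
  have hS := Finset.sum_range_succ' (fun k : ℕ => q (k + 1)) m
  simp only [Nat.cast_zero, zero_add, one_mul, Nat.cast_add, Nat.cast_one] at hS ⊢
  have := mul_nonneg hn0.le (hq 1)
  linarith

/-- The partial sums of the generating function of the solution started from `q_1 = 1`. -/
noncomputable def partialGen (w : ℕ → ℝ) (m : ℕ) (x : ℝ) : ℝ :=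
  ∑ k ∈ Finset.range m, convSeq w (k + 1) * x ^ (k + 1)

theorem hasDerivAt_partialGen (w : ℕ → ℝ) (m : ℕ) (x : ℝ) :
    HasDerivAt (partialGen w m)
      (∑ k ∈ Finset.range m, convSeq w (k + 1) * (((k + 1 : ℕ) : ℝ) * x ^ k)) x := by
  unfold partialGen
  exact HasDerivAt.fun_sum fun k _ => (hasDerivAt_pow (k + 1) x).const_mul _

theorem continuous_partialGen (w : ℕ → ℝ) (m : ℕ) : Continuous (partialGen w m) :=
  continuous_iff_continuousAt.2 fun x => (hasDerivAt_partialGen w m x).continuousAt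

theorem partialGen_one (w : ℕ → ℝ) (x : ℝ) : partialGen w 1 x = x := by
  simp [partialGen, convSeq_one]

theorem partialGen_half_le_one (n m : ℕ) : partialGen (fireWeight n) m (1 / 2) ≤ 1 := by
  refine le_trans (Finset.sum_le_sum fun k _ => ?_)
    (sum_le_hasSum (Finset.range m) (fun k _ => limitLaw_nonneg (k + 1)) hasSum_limitLaw_succ)
  refine ((convRec_convSeq fun _ => fireWeight_pos n).mul_pow (1 / 2)).le (k := k + 1)
    (fun _ _ => two_pos) (fun _ => two_le_fireWeight n)
    (fun k => mul_nonneg (convSeq_nonneg (fun _ => fireWeight_pos n) k) (by positivity))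
    convRec_limitLaw ?_ (Nat.le_add_left 1 k)
  rw [limitLaw_one, convSeq_one]
  norm_num

/-- A barrier argument. Where `S ≤ 1` and `z ≥ 1/2`, the differential inequality gives `z S' ≤ n +
2nz + 1 ≤ (4n + 2) z`, so `S` cannot cross a line of slope `4n + 3` while that line is below `1`.
The slope does not depend on `m`. -/
theorem partialGen_le_of_le {n : ℕ} (hn : 1 ≤ n) {x s : ℝ} (hx : 1 / 2 ≤ x) (m : ℕ)
    (hs : partialGen (fireWeight n) m x ≤ s) {y : ℝ} (hxy : x ≤ y)
    (hy : s + (4 * n + 3) * (y - x) ≤ 1) :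
    partialGen (fireWeight n) m y ≤ s + (4 * n + 3) * (y - x) := by
  have hK : (0 : ℝ) < 4 * n + 3 := by positivity
  refine image_le_of_deriv_right_lt_deriv_boundary (f := partialGen (fireWeight n) m)
    (B := fun z => s + (4 * n + 3) * (z - x)) (B' := fun _ => (4 * n + 3 : ℝ)) (b := y)
    (continuous_partialGen _ m).continuousOn
    (fun z _ => (hasDerivAt_partialGen _ m z).hasDerivWithinAt) (by simpa using hs)
    (fun z => ?_) (fun z hz heq => ?_) ⟨hxy, le_rfl⟩
  · simpa using (((hasDerivAt_id z).sub_const x).const_mul (4 * n + 3 : ℝ)).const_add s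
  · have hz0 : 0 < z := by linarith [hz.1]
    have hb := convSeq_nonneg (fun _ => fireWeight_pos n)
    have hle1 : partialGen (fireWeight n) m z ≤ 1 := by
      rw [heq]
      have := mul_le_mul_of_nonneg_left (sub_le_sub_right hz.2.le x) hK.le
      linarith
    have hge0 : 0 ≤ partialGen (fireWeight n) m z :=
      Finset.sum_nonneg fun k _ => mul_nonneg (hb _) (by positivity)
    have hineq := sum_range_mul_le_of_convRec hn
      (fun k => mul_nonneg (hb k) (pow_nonneg hz0.le k))
      ((convRec_convSeq fun _ => fireWeight_pos n).mul_pow z) m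
    change _ ≤ n * partialGen (fireWeight n) m z ^ 2 + _ + partialGen (fireWeight n) m z at hineq
    have hT : ∑ k ∈ Finset.range m,
        ((k : ℝ) + 1) * (convSeq (fireWeight n) (k + 1) * z ^ (k + 1)) =
        z * ∑ k ∈ Finset.range m,
          convSeq (fireWeight n) (k + 1) * (((k + 1 : ℕ) : ℝ) * z ^ k) := by
      rw [Finset.mul_sum]
      refine Finset.sum_congr rfl fun k _ => ?_
      push_cast
      ring
    rw [hT, convSeq_one, pow_one, one_mul] at hineq
    have hn0 : (0 : ℝ) ≤ n := Nat.cast_nonneg n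
    have hsq : (n : ℝ) * partialGen (fireWeight n) m z ^ 2 ≤ n := by
      have := mul_le_mul_of_nonneg_left (pow_le_one₀ (n := 2) hge0 hle1) hn0
      linarith
    have hzhalf : 1 / 2 ≤ z := hx.trans hz.1
    refine lt_of_mul_lt_mul_left (lt_of_le_of_lt hineq ?_) hz0.le
    nlinarith [mul_le_mul_of_nonneg_left hzhalf hn0]

theorem exists_isConvLaw_fireWeight {n : ℕ} (hn : 1 ≤ n) :
    ∃ q, IsConvLaw (fireWeight n) q ∧ Summable (fun k : ℕ => ((k : ℝ) + 1) * q (k + 1)) := by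
  set w := fireWeight n
  have hw : ∀ k, 2 ≤ k → 0 < w k := fun _ => fireWeight_pos n
  have hb := convSeq_nonneg hw
  let A : Set ℝ := {x | 1 / 2 ≤ x ∧ ∀ m, partialGen w m x ≤ 1}
  have hclosed : IsClosed A := by
    have hA : A = Set.Ici (1 / 2) ∩ ⋂ m, {x | partialGen w m x ≤ 1} := by
      ext x
      simp [A]
    rw [hA]
    exact isClosed_Ici.inter (isClosed_iInter fun m =>
      isClosed_le (continuous_partialGen w m) continuous_const)
  -- The first partial sum is `x` itself, so `A` lies in `[1/2, 1]`.
  have hcompact : IsCompact A := (isCompact_Icc (a := (1 / 2 : ℝ)) (b := 1)).of_isClosed_subset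
    hclosed fun x hx => ⟨hx.1, partialGen_one w x ▸ hx.2 1⟩
  obtain ⟨x, hxA, hmax⟩ := hcompact.exists_isGreatest
    ⟨1 / 2, le_rfl, fun m => partialGen_half_le_one n m⟩
  have hx0 : 0 ≤ x := by linarith [hxA.1]
  let q : ℕ → ℝ := fun k => convSeq w k * x ^ k
  have hq : ∀ k, 0 ≤ q k := fun k => mul_nonneg (hb k) (pow_nonneg hx0 k)
  have hrec : ConvRec w q := (convRec_convSeq hw).mul_pow x
  have hsum : Summable fun k => q (k + 1) :=
    summable_of_sum_range_le (fun _ => hq _) hxA.2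
  have hle : ∑' k, q (k + 1) ≤ 1 := hsum.tsum_le_of_sum_range_le hxA.2
  have htsum : ∑' k, q (k + 1) = 1 := by
    refine hle.antisymm (not_lt.1 fun hlt => ?_)
    set s := ∑' k, q (k + 1)
    have hK : (0 : ℝ) < 4 * n + 3 := by positivity
    -- This is the step at which the barrier line starting from height `s` reaches `1`; it would
    -- give an element of `A` beyond its maximum.
    have hδ : 0 < (1 - s) / (4 * n + 3) := div_pos (sub_pos.2 hlt) hK
    have hy : s + (4 * n + 3) * (x + (1 - s) / (4 * n + 3) - x) = 1 := by
      rw [add_sub_cancel_left, mul_div_cancel₀ _ hK.ne']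
      ring
    have hmem : x + (1 - s) / (4 * n + 3) ∈ A := by
      refine ⟨by linarith [hxA.1], fun m => ?_⟩
      refine (partialGen_le_of_le hn hxA.1 m ?_ (by linarith) hy.le).trans hy.le
      exact hsum.sum_le_tsum _ fun k _ => hq (k + 1)
    linarith [hmax hmem]
  refine ⟨q, ⟨by simp [q, convSeq_zero], hq, htsum ▸ hsum.hasSum, hrec⟩, ?_⟩
  -- The differential inequality with `S ≤ 1` also bounds the first moment.
  refine summable_of_sum_range_le (c := n * 1 + 2 * n * q 1 + 1)
    (fun k => mul_nonneg (by positivity) (hq _)) fun m => ?_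
  refine (sum_range_mul_le_of_convRec hn hq hrec m).trans ?_
  have h1 : ∑ k ∈ Finset.range m, q (k + 1) ≤ 1 := hxA.2 m
  have h0 : 0 ≤ ∑ k ∈ Finset.range m, q (k + 1) := Finset.sum_nonneg fun _ _ => hq _
  gcongr
  exact pow_le_one₀ h0 h1

/-! ### Passage between laws and equilibria -/

theorem moment_zero_eq (u : ℕ → ℝ) : moment 0 u = ∑' k, u (k + 1) := by
  simp [moment]

theorem moment_one_eq (u : ℕ → ℝ) : moment 1 u = ∑' k : ℕ, ((k : ℝ) + 1) * u (k + 1) := by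
  simp [moment]

theorem moment_div (i : ℕ) (u : ℕ → ℝ) (a : ℝ) :
    moment i (fun k => u k / a) = moment i u / a := by
  simp only [moment, ← mul_div_assoc, tsum_div_const]

namespace IsEquilibrium

variable {n : ℕ} {c : ℕ → ℝ}

theorem summable (h : IsEquilibrium n c) : Summable fun k => c (k + 1) := by
  have hs : Summable fun k : ℕ => ((k : ℝ) + 1) * c (k + 1) := by
    -- A divergent `tsum` has the value `0`, which contradicts mass `1`.
    by_contra hns
    have := h.mass
    rw [moment_one_eq, tsum_eq_zero_of_not_summable hns] at this
    exact zero_ne_one this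
  refine hs.of_nonneg_of_le (fun k => h.nonneg _) fun k => ?_
  exact le_mul_of_one_le_left (h.nonneg _) (by simp)

theorem moment_zero_pos (h : IsEquilibrium n c) : 0 < moment 0 c := by
  rw [moment_zero_eq]
  refine (tsum_nonneg fun k => h.nonneg _).lt_of_ne fun h0 => ?_
  have hz := h.summable.hasSum
  rw [← h0, hasSum_zero_iff_of_nonneg fun k => h.nonneg _] at hz
  have hm := h.mass
  rw [moment_one_eq] at hm
  simp [fun k => congrFun hz k] at hm

theorem isConvLaw_massDist (h : IsEquilibrium n c) : IsConvLaw (fireWeight n) (massDist c) where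
  zero := by rw [massDist, h.zero, zero_div]
  nonneg k := div_nonneg (h.nonneg k) h.moment_zero_pos.le
  hasSum := by
    have := h.summable.hasSum.div_const (moment 0 c)
    rwa [← moment_zero_eq, div_self h.moment_zero_pos.ne'] at this
  convRec k hk := by
    have hb := h.balance k hk
    have h0 := h.moment_zero_pos.ne'
    simp only [massDist, div_mul_div_comm]
    rw [← Finset.sum_div, fireWeight, ← mul_div_assoc, hb]
    field_simp

theorem moment_one_massDist (h : IsEquilibrium n c) :
    moment 1 (massDist c) = 1 / moment 0 c := by
  rw [← h.mass]
  exact moment_div 1 c (moment 0 c)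

/-- Normalising by `m_0` loses nothing, because `m_1(c) = 1` fixes the scale. -/
theorem eq_massDist_div (h : IsEquilibrium n c) (k : ℕ) :
    c k = massDist c k / moment 1 (massDist c) := by
  have h0 := h.moment_zero_pos.ne'
  rw [h.moment_one_massDist, massDist]
  field_simp

theorem unique {c' : ℕ → ℝ} (h : IsEquilibrium n c) (h' : IsEquilibrium n c') : c = c' := by
  funext k
  rw [h.eq_massDist_div, h'.eq_massDist_div,
    h.isConvLaw_massDist.unique (fun _ => fireWeight_pos n) h'.isConvLaw_massDist]

end IsEquilibrium

theorem IsConvLaw.isEquilibrium {n : ℕ} {q : ℕ → ℝ} (h : IsConvLaw (fireWeight n) q)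
    (hs : Summable fun k : ℕ => ((k : ℝ) + 1) * q (k + 1)) :
    IsEquilibrium n fun k => q k / moment 1 q := by
  have hpos : 0 < moment 1 q := by
    refine one_pos.trans_le ?_
    rw [moment_one_eq]
    exact hasSum_le (fun k => le_mul_of_one_le_left (h.nonneg _) (by simp)) h.hasSum hs.hasSum
  have hm0 : moment 0 (fun k => q k / moment 1 q) = 1 / moment 1 q := by
    rw [moment_div, moment_zero_eq, h.hasSum.tsum_eq]
  refine ⟨by simp [h.zero], fun k => div_nonneg (h.nonneg k) hpos.le, ?_, fun k hk => ?_⟩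
  · rw [moment_div, div_self hpos.ne']
  · have hb := h.convRec k hk
    rw [fireWeight] at hb
    rw [hm0, one_div_one_div, ← mul_div_assoc, hb]
    simp only [div_mul_div_comm, ← Finset.sum_div]
    field_simp

theorem existsUnique_isEquilibrium {n : ℕ} (hn : 1 ≤ n) : ∃! c, IsEquilibrium n c := by
  obtain ⟨q, hq, hs⟩ := exists_isConvLaw_fireWeight hn
  exact ⟨_, hq.isEquilibrium hs, fun c hc => hc.unique (hq.isEquilibrium hs)⟩

/-! ### Convergence to the limit law -/

/-- Otherwise `q` lies below the limit law termwise with the same mass, hence equals it, although `q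
1 < 1/2`. -/
theorem IsConvLaw.half_le {n : ℕ} {q : ℕ → ℝ} (h : IsConvLaw (fireWeight n) q) :
    1 / 2 ≤ q 1 := by
  by_contra! hlt
  have hs := eq_of_hasSum_of_le h.hasSum hasSum_limitLaw_succ fun k =>
    h.convRec.le (fun _ _ => two_pos) (fun _ => two_le_fireWeight n) h.nonneg convRec_limitLaw
      (by rw [limitLaw_one]; exact hlt.le) (Nat.le_add_left 1 k)
  have h1 : q 1 = limitLaw 1 := congrFun hs 0
  rw [limitLaw_one] at h1
  exact hlt.ne h1

/-- At `1/2` the full series already sums to `1`, and passing to `x` multiplies every term by at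
least `2x > 1`; so it suffices that the partial mass exceeds `1 / (2x)`. -/
theorem exists_one_lt_partialGen {x : ℝ} (hx : 1 / 2 < x) :
    ∃ m, 1 < partialGen (fun _ => 2) m x := by
  have hlt : 1 / (2 * x) < 1 := by
    rw [div_lt_one (by linarith)]
    linarith
  obtain ⟨m, hm⟩ := (hasSum_limitLaw_succ.tendsto_sum_nat.eventually_const_lt hlt).exists
  refine ⟨m, ?_⟩
  rw [div_lt_iff₀ (by linarith), Finset.sum_mul] at hm
  refine hm.trans_le (Finset.sum_le_sum fun k _ => ?_)
  have hpow : x ^ (k + 1) = (1 / 2) ^ (k + 1) * (2 * x) ^ (k + 1) := by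
    rw [← mul_pow]
    ring
  have hx1 : 1 ≤ 2 * x := by linarith
  rw [limitLaw_eq_convSeq, hpow, ← mul_assoc (convSeq _ _) _ ((2 * x) ^ _)]
  refine mul_le_mul_of_nonneg_left (le_self_pow₀ hx1 (Nat.succ_ne_zero k)) ?_
  exact mul_nonneg (convSeq_nonneg (fun _ _ => two_pos) _) (by positivity)

theorem tendsto_convSeq_fireWeight (k : ℕ) :
    Tendsto (fun n => convSeq (fireWeight n) k) atTop (𝓝 (convSeq (fun _ => 2) k)) :=
  tendsto_convSeq (fun _ _ => two_ne_zero) (fun k _ => tendsto_fireWeight k) k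

theorem tendsto_apply_one_of_isConvLaw {q : ℕ → ℕ → ℝ}
    (h : ∀ᶠ n in atTop, IsConvLaw (fireWeight n) (q n)) :
    Tendsto (fun n => q n 1) atTop (𝓝 (1 / 2)) := by
  refine tendsto_order.2 ⟨fun a ha => ?_, fun x hx => ?_⟩
  · filter_upwards [h] with n hn using ha.trans_le hn.half_le
  · obtain ⟨m, hm⟩ := exists_one_lt_partialGen hx
    have hlim : Tendsto (fun n => partialGen (fireWeight n) m x) atTop
        (𝓝 (partialGen (fun _ => 2) m x)) :=
      tendsto_finsetSum _ fun k _ => (tendsto_convSeq_fireWeight (k + 1)).mul_const _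
    filter_upwards [h, hlim.eventually_const_lt hm] with n hn hlt
    by_contra! hle
    -- If `q n 1 ≥ x`, the partial sum at `x` is at most the mass `1` of the law.
    refine hlt.not_ge (le_trans (Finset.sum_le_sum fun k _ => ?_)
      (sum_le_hasSum (Finset.range m) (fun k _ => hn.nonneg (k + 1)) hn.hasSum))
    rw [hn.eq_convSeq_mul_pow (fun _ => fireWeight_pos n) (k + 1)]
    exact mul_le_mul_of_nonneg_left (pow_le_pow_left₀ (by linarith) hle _)
      (convSeq_nonneg (fun _ => fireWeight_pos n) _)

theorem tendsto_apply_of_isConvLaw {q : ℕ → ℕ → ℝ}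
    (h : ∀ᶠ n in atTop, IsConvLaw (fireWeight n) (q n)) (k : ℕ) :
    Tendsto (fun n => q n k) atTop (𝓝 (limitLaw k)) := by
  rw [limitLaw_eq_convSeq]
  refine ((tendsto_convSeq_fireWeight k).mul
    ((tendsto_apply_one_of_isConvLaw h).pow k)).congr' ?_
  filter_upwards [h] with n hn using
    (hn.eq_convSeq_mul_pow (fun _ => fireWeight_pos n) k).symm

/-- Scheffé's lemma for series. -/
theorem tendsto_tsum_abs_sub_of_hasSum {f : ℕ → ℕ → ℝ} {g : ℕ → ℝ} {a : ℝ}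
    (hf0 : ∀ᶠ n in atTop, ∀ k, 0 ≤ f n k) (hf : ∀ᶠ n in atTop, HasSum (f n) a)
    (hg0 : ∀ k, 0 ≤ g k) (hg : HasSum g a)
    (hlim : ∀ k, Tendsto (fun n => f n k) atTop (𝓝 (g k))) :
    Tendsto (fun n => ∑' k, |f n k - g k|) atTop (𝓝 0) := by
  -- The positive part `(g - f)⁺` is dominated by `g`. It suffices, because `|f - g| = (f - g) + 2
  -- (g - f)⁺` and `f - g` sums to `0`.
  have hdom : Tendsto (fun n => ∑' k, max (g k - f n k) 0) atTop (𝓝 (∑' _ : ℕ, (0 : ℝ))) := by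
    refine tendsto_tsum_of_dominated_convergence hg.summable (fun k => ?_) ?_
    · simpa using ((hlim k).const_sub (g k)).max (tendsto_const_nhds (x := (0 : ℝ)))
    · filter_upwards [hf0] with n hn k
      rw [Real.norm_of_nonneg (le_max_right _ _)]
      exact max_le (sub_le_self _ (hn k)) (hg0 k)
  rw [tsum_zero] at hdom
  have h2 := hdom.const_mul 2
  rw [mul_zero] at h2
  refine h2.congr' ?_
  filter_upwards [hf0, hf] with n hn0 hn
  have hmax : Summable fun k => max (g k - f n k) 0 :=
    hg.summable.of_nonneg_of_le (fun k => le_max_right _ _)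
      fun k => max_le (sub_le_self _ (hn0 k)) (hg0 k)
  have hsum := (hn.sub hg).add (hmax.hasSum.mul_left 2)
  rw [sub_self, zero_add] at hsum
  rw [← hsum.tsum_eq]
  refine tsum_congr fun k => ?_
  rcases le_total (f n k) (g k) with hle | hle
  · rw [max_eq_left (sub_nonneg.2 hle), abs_of_nonpos (sub_nonpos.2 hle)]
    ring
  · rw [max_eq_right (sub_nonpos.2 hle), abs_of_nonneg (sub_nonneg.2 hle)]
    ring

/-! ### Leaves of the critical binary Galton–Watson tree -/

theorem nil_mem_tree (ξ : List ℕ → ℕ) : [] ∈ tree ξ := by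
  intro v i h
  simp at h

theorem cons_mem_tree {ξ : List ℕ → ℕ} {i : ℕ} {u : List ℕ} :
    i :: u ∈ tree ξ ↔ i < ξ [] ∧ u ∈ tree fun v => ξ (i :: v) := by
  constructor
  · intro h
    refine ⟨h [] i (by simp), fun v j hv => h (i :: v) j ?_⟩
    simpa using hv
  · rintro ⟨hi, hu⟩ v j hv
    rcases v with _ | ⟨a, v⟩
    · rw [List.nil_append, List.cons_prefix_cons] at hv
      exact hv.1 ▸ hi
    · rw [List.cons_append, List.cons_prefix_cons] at hv
      obtain ⟨rfl, hv⟩ := hv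
      exact hu v j hv

theorem nil_mem_leaves {ξ : List ℕ → ℕ} : [] ∈ leaves ξ ↔ ξ [] = 0 :=
  and_iff_right (nil_mem_tree ξ)

theorem cons_mem_leaves {ξ : List ℕ → ℕ} {i : ℕ} {u : List ℕ} :
    i :: u ∈ leaves ξ ↔ i < ξ [] ∧ u ∈ leaves fun v => ξ (i :: v) := by
  change i :: u ∈ tree ξ ∧ _ ↔ _ ∧ u ∈ tree _ ∧ _
  rw [cons_mem_tree, and_assoc]

theorem encard_leaves_of_root_eq_zero {ξ : List ℕ → ℕ} (h : ξ [] = 0) :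
    (leaves ξ).encard = 1 := by
  rw [Set.encard_eq_one]
  refine ⟨[], Set.ext fun u => ?_⟩
  rcases u with _ | ⟨i, u⟩
  · simp [nil_mem_leaves, h]
  · simp [cons_mem_leaves, h]

theorem encard_leaves_of_root_eq_two {ξ : List ℕ → ℕ} (h : ξ [] = 2) :
    (leaves ξ).encard =
      (leaves fun v => ξ (0 :: v)).encard + (leaves fun v => ξ (1 :: v)).encard := by
  have hunion : leaves ξ = List.cons 0 '' (leaves fun v => ξ (0 :: v)) ∪
      List.cons 1 '' (leaves fun v => ξ (1 :: v)) := by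
    ext u
    rcases u with _ | ⟨i, u⟩
    · simp [nil_mem_leaves, h]
    · rcases i with _ | _ | i <;> simp [cons_mem_leaves, h]
  rw [hunion, Set.encard_union_eq, List.cons_injective.encard_image,
    List.cons_injective.encard_image]
  rw [Set.disjoint_left]
  rintro _ ⟨u, -, rfl⟩ ⟨v, -, hv⟩
  simp at hv

theorem measurableSet_mem_leaves (u : List ℕ) :
    MeasurableSet {ξ : List ℕ → ℕ | u ∈ leaves ξ} := by
  have h : {ξ : List ℕ → ℕ | u ∈ leaves ξ} =
      (⋂ (v : List ℕ) (i : ℕ) (_ : v ++ [i] <+: u), {ξ | i < ξ v}) ∩ {ξ | ξ u = 0} := by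
    ext ξ
    simp [leaves, tree]
  rw [h]
  refine MeasurableSet.inter (MeasurableSet.iInter fun v => MeasurableSet.iInter fun i =>
    MeasurableSet.iInter fun _ => ?_) ?_
  · exact measurable_pi_apply v (MeasurableSet.of_discrete (s := Set.Ioi i))
  · exact measurable_pi_apply u (measurableSet_singleton 0)

/-- There are only countably many finite sets of words that can witness `k` leaves. -/
theorem measurableSet_le_encard_leaves (k : ℕ) :
    MeasurableSet {ξ : List ℕ → ℕ | (k : ℕ∞) ≤ (leaves ξ).encard} := by
  have h : {ξ : List ℕ → ℕ | (k : ℕ∞) ≤ (leaves ξ).encard} =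
      ⋃ (t : Finset (List ℕ)) (_ : t.card = k), ⋂ u ∈ t, {ξ | u ∈ leaves ξ} := by
    ext ξ
    simp only [Set.mem_iUnion, Set.mem_iInter, Set.mem_ofPred_eq, exists_prop]
    constructor
    · intro hk
      obtain ⟨t, hts, htk⟩ := Set.exists_subset_encard_eq hk
      have hfin : t.Finite := Set.finite_of_encard_eq_coe htk
      refine ⟨hfin.toFinset, ?_, fun u hu => hts (hfin.mem_toFinset.1 hu)⟩
      rw [hfin.encard_eq_coe_toFinset_card] at htk
      exact_mod_cast htk
    · rintro ⟨t, rfl, ht⟩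
      rw [← Set.encard_coe_eq_coe_finsetCard]
      exact Set.encard_le_encard fun u hu => ht u (Finset.mem_coe.1 hu)
  rw [h]
  exact MeasurableSet.iUnion fun t => MeasurableSet.iUnion fun _ =>
    Finset.measurableSet_biInter _ fun u _ => measurableSet_mem_leaves u

theorem measurableSet_encard_leaves_eq (k : ℕ) :
    MeasurableSet {ξ : List ℕ → ℕ | (leaves ξ).encard = (k : ℕ∞)} := by
  have h : {ξ : List ℕ → ℕ | (leaves ξ).encard = (k : ℕ∞)} =
      {ξ | (k : ℕ∞) ≤ (leaves ξ).encard} \ {ξ | ((k + 1 : ℕ) : ℕ∞) ≤ (leaves ξ).encard} := by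
    ext ξ
    simp only [Set.mem_ofPred_eq, Set.mem_sdiff, not_le]
    rw [Nat.cast_add, Nat.cast_one, ENat.lt_natCast_add_one_iff, le_antisymm_iff, and_comm]
  rw [h]
  exact (measurableSet_le_encard_leaves k).diff (measurableSet_le_encard_leaves (k + 1))

theorem criticalBinary_singleton_zero : criticalBinary {0} = 2⁻¹ := by
  simp [criticalBinary]

theorem criticalBinary_singleton_two : criticalBinary {2} = 2⁻¹ := by
  simp [criticalBinary]

theorem criticalBinary_compl : criticalBinary {0, 2}ᶜ = 0 := by
  simp [criticalBinary]

theorem measurableSet_subtree_preimage {Ω : Type*} (ξ : List ℕ → Ω → ℕ) (i : ℕ)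
    {A : Set (List ℕ → ℕ)} (hA : MeasurableSet A) :
    MeasurableSet[⨆ u ∈ Set.range (List.cons i), MeasurableSpace.comap (ξ u) inferInstance]
      ((fun ω u => ξ (i :: u) ω) ⁻¹' A) := by
  let _ : MeasurableSpace Ω :=
    ⨆ u ∈ Set.range (List.cons i), MeasurableSpace.comap (ξ u) inferInstance
  have hm : Measurable fun ω u => ξ (i :: u) ω := measurable_pi_iff.2 fun u =>
    (comap_measurable (ξ (i :: u))).mono
      (le_iSup₂_of_le (i :: u) (Set.mem_range_self u) le_rfl) le_rfl
  exact hm hA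

namespace IsGaltonWatson

variable {Ω : Type*} [MeasurableSpace Ω] {P : Measure Ω} {ν : Measure ℕ} {ξ : List ℕ → Ω → ℕ}

theorem subtree (h : IsGaltonWatson P ν ξ) (i : ℕ) :
    IsGaltonWatson P ν fun u => ξ (i :: u) where
  measurable _ := h.measurable _
  indep := h.indep.precomp List.cons_injective
  law _ := h.law _

theorem measure_root (h : IsGaltonWatson P ν ξ) (s : Set ℕ) : P (ξ [] ⁻¹' s) = ν s := by
  rw [← h.law [], Measure.map_apply (h.measurable []) MeasurableSet.of_discrete]

theorem measurable_pi (h : IsGaltonWatson P ν ξ) : Measurable fun ω u => ξ u ω :=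
  measurable_pi_iff.2 h.measurable

/-- The root and the words starting with `0` and with `1` are disjoint blocks of indices, so the
σ-algebras they generate are independent. -/
theorem measure_root_inter_subtrees (h : IsGaltonWatson P ν ξ) (s : Set ℕ)
    {A B : Set (List ℕ → ℕ)} (hA : MeasurableSet A) (hB : MeasurableSet B) :
    P (ξ [] ⁻¹' s ∩ ((fun ω u => ξ (0 :: u) ω) ⁻¹' A ∩ (fun ω u => ξ (1 :: u) ω) ⁻¹' B)) =
      ν s * (P ((fun ω u => ξ (0 :: u) ω) ⁻¹' A) * P ((fun ω u => ξ (1 :: u) ω) ⁻¹' B)) := by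
  let m : List ℕ → MeasurableSpace Ω := fun u => MeasurableSpace.comap (ξ u) inferInstance
  have hle : ∀ u, m u ≤ ‹MeasurableSpace Ω› := fun u => (h.measurable u).comap_le
  have hind : iIndep m P := h.indep.iIndep
  have hsub : Indep (⨆ u ∈ Set.range (List.cons 0), m u) (⨆ u ∈ Set.range (List.cons 1), m u) P := by
    refine indep_iSup_of_disjoint hle hind (Set.disjoint_left.2 ?_)
    rintro _ ⟨u, rfl⟩ ⟨v, hv⟩
    simp at hv
  have hroot : Indep (⨆ u ∈ ({[]} : Set (List ℕ)), m u)
      (⨆ u ∈ Set.range (List.cons 0) ∪ Set.range (List.cons 1), m u) P := by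
    refine indep_iSup_of_disjoint hle hind (Set.disjoint_left.2 ?_)
    rintro _ rfl (⟨v, hv⟩ | ⟨v, hv⟩) <;> simp at hv
  have hA' := measurableSet_subtree_preimage ξ 0 hA
  have hB' := measurableSet_subtree_preimage ξ 1 hB
  rw [(Indep_iff _ _ P).1 hroot, (Indep_iff _ _ P).1 hsub _ _ hA' hB', h.measure_root]
  · have hr : MeasurableSet[m []] (ξ [] ⁻¹' s) := ⟨s, MeasurableSet.of_discrete, rfl⟩
    exact le_iSup₂ (f := fun u (_ : u ∈ ({[]} : Set (List ℕ))) => m u) [] rfl _ hr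
  · rw [iSup_union]
    exact MeasurableSet.inter (le_sup_left (α := MeasurableSpace Ω) _ hA')
      (le_sup_right (α := MeasurableSpace Ω) _ hB')

/-- The branching property: a childless root is the only leaf, and with two children the counts of
the subtrees add up. The two subtree probabilities are kept apart, as their equality is not yet
known. -/
theorem measure_encard_leaves (h : IsGaltonWatson P criticalBinary ξ) (k : ℕ) :
    P {ω | (leaves fun u => ξ u ω).encard = (k : ℕ∞)} =
      (if k = 1 then 2⁻¹ else 0) + 2⁻¹ * ∑ ij ∈ Finset.HasAntidiagonal.antidiagonal k,
        P {ω | (leaves fun u => ξ (0 :: u) ω).encard = (ij.1 : ℕ∞)} *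
          P {ω | (leaves fun u => ξ (1 :: u) ω).encard = (ij.2 : ℕ∞)} := by
  set L := {ω | (leaves fun u => ξ u ω).encard = (k : ℕ∞)}
  have hL : MeasurableSet L := h.measurable_pi (measurableSet_encard_leaves_eq k)
  have hm : ∀ s : Set ℕ, MeasurableSet (ξ [] ⁻¹' s) := fun s =>
    h.measurable [] MeasurableSet.of_discrete
  have hsplit : P L = P (ξ [] ⁻¹' {0} ∩ L) + P (ξ [] ⁻¹' {2} ∩ L) := by
    have hae : L =ᵐ[P] (ξ [] ⁻¹' {0} ∩ L ∪ ξ [] ⁻¹' {2} ∩ L : Set Ω) := by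
      have hroot : ∀ᵐ ω ∂P, ω ∈ ξ [] ⁻¹' {0, 2} := by
        rw [ae_iff]
        exact (h.measure_root {0, 2}ᶜ).trans criticalBinary_compl
      filter_upwards [hroot] with ω hω
      refine propext ⟨fun hl => ?_, fun hl => hl.elim And.right And.right⟩
      rcases hω with h0 | h2
      · exact Or.inl ⟨h0, hl⟩
      · exact Or.inr ⟨h2, hl⟩
    rw [measure_congr hae, measure_union _ ((hm {2}).inter hL)]
    rw [Set.disjoint_left]
    rintro ω ⟨h0, -⟩ ⟨h2, -⟩
    simp only [Set.mem_preimage, Set.mem_singleton_iff] at h0 h2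
    lia
  rw [hsplit]
  congr 1
  · split_ifs with hk
    · rw [← criticalBinary_singleton_zero, ← h.measure_root]
      congr 1
      refine Set.inter_eq_left.2 fun ω hω => ?_
      change (leaves fun u => ξ u ω).encard = (k : ℕ∞)
      rw [encard_leaves_of_root_eq_zero (ξ := fun u => ξ u ω) hω, hk, Nat.cast_one]
    · rw [← measure_empty (μ := P)]
      congr 1
      refine Set.eq_empty_of_forall_notMem fun ω ⟨hω, hl⟩ => hk ?_
      change (leaves fun u => ξ u ω).encard = (k : ℕ∞) at hl
      rw [encard_leaves_of_root_eq_zero (ξ := fun u => ξ u ω) hω] at hl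
      exact_mod_cast hl.symm
  · let E : ℕ × ℕ → Set Ω := fun ij => ξ [] ⁻¹' {2} ∩
      ((fun ω u => ξ (0 :: u) ω) ⁻¹' {ζ | (leaves ζ).encard = (ij.1 : ℕ∞)} ∩
        (fun ω u => ξ (1 :: u) ω) ⁻¹' {ζ | (leaves ζ).encard = (ij.2 : ℕ∞)})
    have hE : ξ [] ⁻¹' {2} ∩ L = ⋃ ij ∈ Finset.HasAntidiagonal.antidiagonal k, E ij := by
      ext ω
      simp only [Set.mem_iUnion, exists_prop]
      constructor
      · rintro ⟨hω, hl⟩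
        change (leaves fun u => ξ u ω).encard = (k : ℕ∞) at hl
        rw [encard_leaves_of_root_eq_two (ξ := fun u => ξ u ω) hω] at hl
        -- The total `k` is finite, so neither subtree has infinitely many leaves.
        have h0 : (leaves fun u => ξ (0 :: u) ω).encard ≠ ⊤ := by
          intro htop
          simp [htop] at hl
        have h1 : (leaves fun u => ξ (1 :: u) ω).encard ≠ ⊤ := by
          intro htop
          simp [htop] at hl
        obtain ⟨i, hi⟩ := ENat.ne_top_iff_exists.1 h0
        obtain ⟨j, hj⟩ := ENat.ne_top_iff_exists.1 h1
        rw [← hi, ← hj] at hl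
        exact ⟨(i, j), Finset.HasAntidiagonal.mem_antidiagonal.2 (by exact_mod_cast hl), hω, hi.symm, hj.symm⟩
      · rintro ⟨ij, hij, hω, hi, hj⟩
        refine ⟨hω, ?_⟩
        change (leaves fun u => ξ (0 :: u) ω).encard = (ij.1 : ℕ∞) at hi
        change (leaves fun u => ξ (1 :: u) ω).encard = (ij.2 : ℕ∞) at hj
        change (leaves fun u => ξ u ω).encard = (k : ℕ∞)
        rw [encard_leaves_of_root_eq_two (ξ := fun u => ξ u ω) hω, hi, hj, ← Finset.HasAntidiagonal.mem_antidiagonal.1 hij,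
          Nat.cast_add]
    have hEm : ∀ ij, MeasurableSet (E ij) := fun ij => (hm {2}).inter
      (((h.subtree 0).measurable_pi (measurableSet_encard_leaves_eq ij.1)).inter
        ((h.subtree 1).measurable_pi (measurableSet_encard_leaves_eq ij.2)))
    rw [hE, measure_biUnion_finset _ fun ij _ => hEm ij, Finset.mul_sum]
    · refine Finset.sum_congr rfl fun ij _ => ?_
      rw [← criticalBinary_singleton_two]
      exact h.measure_root_inter_subtrees {2} (measurableSet_encard_leaves_eq ij.1)
        (measurableSet_encard_leaves_eq ij.2)
    · intro ij _ kl _ hne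
      refine Set.disjoint_left.2 ?_
      rintro ω ⟨-, hi, hj⟩ ⟨-, hk, hl⟩
      refine hne (Prod.ext ?_ ?_)
      · exact_mod_cast hi.symm.trans hk
      · exact_mod_cast hj.symm.trans hl

/-- A leafless tree almost surely has two children at the root and leafless subtrees. Bounding one
subtree by induction and the other by `1` gains a factor `1/2` per generation. -/
theorem measure_leaves_eq_zero (h : IsGaltonWatson P criticalBinary ξ) [IsProbabilityMeasure P] :
    P {ω | (leaves fun u => ξ u ω).encard = ((0 : ℕ) : ℕ∞)} = 0 := by
  have hle : ∀ n : ℕ, ∀ ζ : List ℕ → Ω → ℕ, IsGaltonWatson P criticalBinary ζ →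
      P {ω | (leaves fun u => ζ u ω).encard = ((0 : ℕ) : ℕ∞)} ≤ 2⁻¹ ^ n := by
    intro n
    induction n with
    | zero => exact fun ζ _ => by simpa using prob_le_one
    | succ n ih =>
      intro ζ hζ
      rw [hζ.measure_encard_leaves 0, if_neg zero_ne_one, zero_add,
        Finset.Nat.antidiagonal_zero, Finset.sum_singleton, pow_succ']
      refine mul_le_mul_right ?_ _
      calc _ ≤ (2⁻¹ : ℝ≥0∞) ^ n * 1 := mul_le_mul' (ih _ (hζ.subtree 0)) prob_le_one
        _ = 2⁻¹ ^ n := mul_one _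
  have hlim : Tendsto (fun n : ℕ => (2⁻¹ : ℝ≥0∞) ^ n) atTop (𝓝 0) :=
    ENNReal.tendsto_pow_atTop_nhds_zero_of_lt_one (by simp)
  exact le_antisymm (ge_of_tendsto' hlim fun n => hle n ξ h) zero_le

/-- Leafless subtrees being null, the terms `i = 0` and `i = k` vanish. This removes leaf count `k`
itself from the right side and leaves the recursion of the limit law. The induction runs over all
families `ξ`, so that it applies to subtrees. -/
theorem measure_encard_leaves_eq_limitLaw [IsProbabilityMeasure P]
    (h : IsGaltonWatson P criticalBinary ξ) (k : ℕ) :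
    P {ω | (leaves fun u => ξ u ω).encard = (k : ℕ∞)} = ENNReal.ofReal (limitLaw k) := by
  induction k using Nat.strong_induction_on generalizing ξ with
  | _ k ih =>
    have hsum : ∑ ij ∈ Finset.HasAntidiagonal.antidiagonal k,
        P {ω | (leaves fun u => ξ (0 :: u) ω).encard = (ij.1 : ℕ∞)} *
          P {ω | (leaves fun u => ξ (1 :: u) ω).encard = (ij.2 : ℕ∞)} =
        ENNReal.ofReal (∑ i ∈ Finset.Ico 1 k, limitLaw i * limitLaw (k - i)) := by
      rw [Finset.Nat.sum_antidiagonal_eq_sum_range_succ (fun i j =>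
          P {ω | (leaves fun u => ξ (0 :: u) ω).encard = (i : ℕ∞)} *
          P {ω | (leaves fun u => ξ (1 :: u) ω).encard = (j : ℕ∞)}),
        ENNReal.ofReal_sum_of_nonneg fun i _ =>
          mul_nonneg (limitLaw_nonneg _) (limitLaw_nonneg _)]
      symm
      refine Finset.sum_subset_zero_on_sdiff (fun i hi => ?_) (fun i hi => ?_) (fun i hi => ?_)
      · rw [Finset.mem_Ico] at hi
        exact Finset.mem_range.2 (by lia)
      · rw [Finset.mem_sdiff, Finset.mem_range, Finset.mem_Ico] at hi
        rcases Nat.eq_zero_or_pos i with rfl | hpos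
        · rw [(h.subtree 0).measure_leaves_eq_zero, zero_mul]
        · rw [show k - i = 0 by lia, (h.subtree 1).measure_leaves_eq_zero, mul_zero]
      · rw [Finset.mem_Ico] at hi
        rw [ih i hi.2 (h.subtree 0), ih (k - i) (by lia) (h.subtree 1),
          ENNReal.ofReal_mul (limitLaw_nonneg _)]
    have hhalf : (2⁻¹ : ℝ≥0∞) = ENNReal.ofReal (1 / 2) := by
      rw [one_div, ENNReal.ofReal_inv_of_pos two_pos, ENNReal.ofReal_ofNat]
    rw [h.measure_encard_leaves, hsum]
    match k with
    | 0 => simp [limitLaw_zero]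
    | 1 => simp [limitLaw_one]
    | k + 2 =>
      rw [if_neg (by lia), zero_add, hhalf, ← ENNReal.ofReal_mul (by norm_num),
        ← limitLaw_balance (Nat.le_add_left 2 k)]

end IsGaltonWatson

end ForestFire

/-! ### The theorem -/

theorem theorem2 :
    (∀ n : ℕ, 1 ≤ n → ∃! c : ℕ → ℝ, ForestFire.IsEquilibrium n c) ∧
    (∀ c : ℕ → ℕ → ℝ, (∀ n, 1 ≤ n → ForestFire.IsEquilibrium n (c n)) →
      (∀ n, 1 ≤ n → (∀ k, 0 ≤ ForestFire.massDist (c n) k) ∧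
        HasSum (fun k => ForestFire.massDist (c n) (k + 1)) 1) ∧
      (∀ n, 1 ≤ n → Summable
        (fun k => |ForestFire.massDist (c n) (k + 1) - ForestFire.limitLaw (k + 1)|)) ∧
      Tendsto
        (fun n => ∑' k, |ForestFire.massDist (c n) (k + 1) - ForestFire.limitLaw (k + 1)|)
        atTop (𝓝 0)) ∧
    (∀ (Ω : Type*) [MeasurableSpace Ω] (P : Measure Ω) [IsProbabilityMeasure P]
      (ξ : List ℕ → Ω → ℕ), ForestFire.IsGaltonWatson P ForestFire.criticalBinary ξ →
      ∀ k : ℕ, 1 ≤ k →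
        P {ω | (ForestFire.leaves (fun u => ξ u ω)).encard = (k : ℕ∞)} =
          ENNReal.ofReal (ForestFire.limitLaw k)) ∧
    (ForestFire.IsLimitSolution ForestFire.limitLaw ∧
      ∀ q : ℕ → ℝ, ForestFire.IsLimitSolution q → q = ForestFire.limitLaw) ∧
    ForestFire.limitLaw ~[atTop]
      (fun k : ℕ => 1 / (2 * Real.sqrt Real.pi * (k : ℝ) ^ (3 / 2 : ℝ))) := by
  refine ⟨fun n hn => ForestFire.existsUnique_isEquilibrium hn, fun c hc => ?_,
    fun Ω _ P _ ξ h k _ => h.measure_encard_leaves_eq_limitLaw k,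
    ⟨ForestFire.isLimitSolution_limitLaw, fun q hq =>
      hq.isConvLaw.unique (fun _ _ => two_pos)
        ForestFire.isLimitSolution_limitLaw.isConvLaw⟩,
    ForestFire.limitLaw_isEquivalent⟩
  have hlaw : ∀ n, 1 ≤ n →
      ForestFire.IsConvLaw (ForestFire.fireWeight n) (ForestFire.massDist (c n)) :=
    fun n hn => (hc n hn).isConvLaw_massDist
  have hev : ∀ᶠ n in atTop,
      ForestFire.IsConvLaw (ForestFire.fireWeight n) (ForestFire.massDist (c n)) :=
    (eventually_ge_atTop 1).mono hlaw
  refine ⟨fun n hn => ⟨(hlaw n hn).nonneg, (hlaw n hn).hasSum⟩, fun n hn => ?_, ?_⟩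
  · exact ((hlaw n hn).hasSum.summable.sub ForestFire.hasSum_limitLaw_succ.summable).abs
  · exact ForestFire.tendsto_tsum_abs_sub_of_hasSum
      (hev.mono fun n hn k => hn.nonneg (k + 1)) (hev.mono fun n hn => hn.hasSum)
      (fun k => ForestFire.limitLaw_nonneg (k + 1)) ForestFire.hasSum_limitLaw_succ
      fun k => ForestFire.tendsto_apply_of_isConvLaw hev (k + 1)
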